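/- Let $G$ be a real, connected, compact Lie group whose Lie algebra $\mathfrak g$ is semisimple. Let $\kappa$ be the Killing form of $\mathfrak g$, and equip $G$ with the (bi-invariant) Riemannian metric $\langle v,w\rangle_g=-\kappa\big((dL_{g^{-1}})_g v,(dL_{g^{-1}})_g w\big)$ for $v,w\in T_gG$, where $L_x$ denotes left translation by $x$. Let $\rho$ be the associated Riemannian distance, $$\rho(x,y)=\inf_{\sigma}\int_0^1\langle\dot\sigma(s),\dot\sigma(s)\rangle^{1/2}\,ds ,$$ the infimum being taken over all $C^1$ curves $\sigma:[0,1]\to G$ with $\sigma(0)=x$ and $\sigma(1)=y$. Let $\mathcal X$ be a linear vector field on $G$, that is, a smooth vector field whose flow $(\varphi_t)_{t\in\mathbb R}$ consists of Lie group automorphisms of $G$. Then, for every $t\in\mathbb R$, the map $\varphi_t$ is an isometry of $(G,\rho)$: it is a bijection of $G$ and $$\rho(\varphi_t(g),\varphi_t(h))=\rho(g,h)\qquad\text{for all } g,h\in G .$$ -/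

import Mathlib

open scoped Manifold ContDiff

noncomputable section

namespace KillingIsometry

variable {E : Type*} [NormedAddCommGroup E] [NormedSpace ℝ E]
  {H : Type*} [TopologicalSpace H] (I : ModelWithCorners ℝ E H)
  {G : Type*} [TopologicalSpace G] [ChartedSpace H G] [Group G]

/-- A smooth real Lie group has the regularity under which Mathlib puts the Lie bracket on its
tangent space at the identity. -/
instance instLieGroupMinSmoothness [LieGroup I ∞ G] : LieGroup I (minSmoothness ℝ 3) G := by
  rw [minSmoothness_of_isRCLikeNormedField]
  exact LieGroup.of_le (n := ∞) (ENat.LEInfty.out)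

/-- `f` is an automorphism of the Lie group `G`: a group automorphism that is smooth together with
its inverse. -/
def IsLieGroupAutomorphism (f : G → G) : Prop :=
  ∃ e : G ≃* G, ⇑e = f ∧ ContMDiff I I ∞ e ∧ ContMDiff I I ∞ e.symm

/-- `φ` is the (global) flow of the vector field `X`: `t ↦ φ t g` is the solution on `ℝ` of
`ġ = X(g)` starting at `g`. -/
structure IsFlowOf (X : (g : G) → TangentSpace I g) (φ : ℝ → G → G) : Prop where
  map_zero : ∀ g, φ 0 g = g
  isMIntegralCurve : ∀ g, IsMIntegralCurve (I := I) (fun t ↦ φ t g) X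

/-- A linear vector field on a Lie group: a smooth vector field whose flow is a family of
automorphisms of the Lie group. -/
structure IsLinearVectorField [LieGroup I ∞ G] (X : (g : G) → TangentSpace I g) : Prop where
  contMDiff : ContMDiff I I.tangent ∞ (fun g ↦ (⟨g, X g⟩ : TangentBundle I G))
  exists_flow : ∃ φ : ℝ → G → G, IsFlowOf I X φ ∧ ∀ t, IsLieGroupAutomorphism I (φ t)

/-- The tangent vector `v` at `g`, carried to the Lie algebra by the differential of the left
translation by `g⁻¹`. -/
def toLieAlgebra (g : G) (v : TangentSpace I g) : GroupLieAlgebra I G :=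
  mfderiv I I (fun h : G ↦ g⁻¹ * h) g v

variable [CompleteSpace E] [LieGroup I ∞ G]

/-- The left-invariant extension to `G` of the negative of the Killing form of the Lie algebra
(for `G` compact and semisimple, a bi-invariant Riemannian metric). -/
def killingMetric (g : G) (v w : TangentSpace I g) : ℝ :=
  -killingForm ℝ (GroupLieAlgebra I G) (toLieAlgebra I g v) (toLieAlgebra I g w)

/-- The length `⟨v, v⟩ ^ (1 / 2)` of a tangent vector for the negative of the Killing form.
On a compact semisimple group the radicand is nonnegative, as the Killing form is negative
definite. -/
abbrev killingENorm (g : G) : ENorm (TangentSpace I g) where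
  enorm v := ENNReal.ofReal √(killingMetric I g v v)

/-- The Riemannian distance of the metric given by the negative of the Killing form: the infimum
of the lengths `∫₀¹ ⟨σ'(s), σ'(s)⟩ ^ (1 / 2) ds` of the `C¹` curves `σ` from `x` to `y`. -/
def killingEDist (x y : G) : ENNReal :=
  letI : ∀ g : G, ENorm (TangentSpace I g) := killingENorm I
  Manifold.riemannianEDist I x y

end KillingIsometry

end

/-!
An automorphism of `G` intertwines left translations, so its differential carries left-invariant
vector fields to left-invariant vector fields. Hence its differential at the identity is an
automorphism of the Lie algebra, which preserves the Killing form, and in the left trivialization of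
the tangent bundle the differential at any point is this same map. The automorphism therefore
preserves the lengths of tangent vectors and of curves. Since a `C¹` vector field has only one flow,
every `φ t` is such an automorphism.
-/

namespace KillingIsometry

section RiemannianEDist

variable {E : Type*} [NormedAddCommGroup E] [NormedSpace ℝ E]
  {E' : Type*} [NormedAddCommGroup E'] [NormedSpace ℝ E']
  {H : Type*} [TopologicalSpace H] {I : ModelWithCorners ℝ E H}
  {H' : Type*} [TopologicalSpace H'] {J : ModelWithCorners ℝ E' H'}
  {M : Type*} [TopologicalSpace M] [ChartedSpace H M] [∀ x : M, ENorm (TangentSpace I x)]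
  {M' : Type*} [TopologicalSpace M'] [ChartedSpace H' M'] [∀ x : M', ENorm (TangentSpace J x)]

lemma riemannianEDist_map_le {f : M → M'} (hf : ContMDiff I J 1 f)
    (hnorm : ∀ (x : M) (v : TangentSpace I x), ‖mfderiv I J f x v‖ₑ ≤ ‖v‖ₑ) (x y : M) :
    Manifold.riemannianEDist J (f x) (f y) ≤ Manifold.riemannianEDist I x y := by
  simp only [Manifold.riemannianEDist]
  refine le_iInf₂ fun γ hγ ↦ iInf₂_le_of_le (γ.map hf.continuous) (hf.comp hγ) ?_
  refine MeasureTheory.lintegral_mono fun s ↦ ?_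
  have chain_rule : mfderiv (𝓡∂ 1) J (f ∘ γ) s 1 =
      mfderiv I J f (γ s) (mfderiv (𝓡∂ 1) I γ s 1) :=
    mfderiv_comp_apply _ (hf.mdifferentiable one_ne_zero _) (hγ.mdifferentiable one_ne_zero _) _
  calc ‖mfderiv (𝓡∂ 1) J (f ∘ γ) s 1‖ₑ
      = ‖mfderiv I J f (γ s) (mfderiv (𝓡∂ 1) I γ s 1)‖ₑ := congrArg _ chain_rule
    _ ≤ ‖mfderiv (𝓡∂ 1) I γ s 1‖ₑ := hnorm _ _

lemma riemannianEDist_diffeomorph {n : ℕ∞ω} (hn : n ≠ 0) (Φ : M ≃ₘ^n⟮I, J⟯ M')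
    (hnorm : ∀ (x : M) (v : TangentSpace I x), ‖mfderiv I J Φ x v‖ₑ = ‖v‖ₑ) (x y : M) :
    Manifold.riemannianEDist J (Φ x) (Φ y) = Manifold.riemannianEDist I x y := by
  have hnorm_symm (z : M') (w : TangentSpace J z) : ‖mfderiv J I Φ.symm z w‖ₑ = ‖w‖ₑ := by
    have chain_rule : mfderiv J J (Φ ∘ Φ.symm) z w =
        mfderiv I J Φ (Φ.symm z) (mfderiv J I Φ.symm z w) :=
      mfderiv_comp_apply _ (Φ.mdifferentiable hn _) (Φ.symm.mdifferentiable hn _) w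
    have cancel : Φ ∘ Φ.symm = id := funext Φ.apply_symm_apply
    calc ‖mfderiv J I Φ.symm z w‖ₑ
        = ‖mfderiv I J Φ (Φ.symm z) (mfderiv J I Φ.symm z w)‖ₑ := (hnorm _ _).symm
      _ = ‖mfderiv J J (Φ ∘ Φ.symm) z w‖ₑ := congrArg _ chain_rule.symm
      _ = ‖w‖ₑ := by rw [cancel, mfderiv_id]; rfl
  have one_le : 1 ≤ n := ENat.one_le_iff_ne_zero_withTop.mpr hn
  refine le_antisymm (riemannianEDist_map_le (Φ.contMDiff.of_le one_le)
    (fun x v ↦ (hnorm x v).le) x y) ?_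
  simpa only [Φ.symm_apply_apply] using riemannianEDist_map_le (Φ.symm.contMDiff.of_le one_le)
    (fun z w ↦ (hnorm_symm z w).le) (Φ x) (Φ y)

end RiemannianEDist

section IntegralCurve

variable {E : Type*} [NormedAddCommGroup E] [NormedSpace ℝ E]
  {H : Type*} [TopologicalSpace H] {I : ModelWithCorners ℝ E H}
  {M : Type*} [TopologicalSpace M] [ChartedSpace H M] [IsManifold I 1 M]
  [BoundarylessManifold I M] [T2Space M]

lemma IsFlowOf.unique {X : (x : M) → TangentSpace I x} {φ ψ : ℝ → M → M}
    (hX : ContMDiff I I.tangent 1 (fun x ↦ (⟨x, X x⟩ : TangentBundle I M)))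
    (hφ : IsFlowOf I X φ) (hψ : IsFlowOf I X ψ) : φ = ψ := by
  funext t x
  have initial : φ 0 x = ψ 0 x := (hφ.map_zero x).trans (hψ.map_zero x).symm
  exact congrFun (isMIntegralCurve_Ioo_eq_of_contMDiff_boundaryless hX
    (hφ.isMIntegralCurve x) (hψ.isMIntegralCurve x) initial) t

end IntegralCurve

section LieAlgebraMap

open VectorField

variable {𝕜 : Type*} [NontriviallyNormedField 𝕜]
  {E : Type*} [NormedAddCommGroup E] [NormedSpace 𝕜 E]
  {E' : Type*} [NormedAddCommGroup E'] [NormedSpace 𝕜 E']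
  {H : Type*} [TopologicalSpace H] {I : ModelWithCorners 𝕜 E H}
  {H' : Type*} [TopologicalSpace H'] {J : ModelWithCorners 𝕜 E' H'}
  {G : Type*} [TopologicalSpace G] [ChartedSpace H G] [Group G]
  {G' : Type*} [TopologicalSpace G'] [ChartedSpace H' G'] [Group G']

variable (I J) in
/-- The differential at the identity of a group homomorphism, as a map between Lie algebras. Its
values lie in the tangent space at `f 1`, which is definitionally the one at `1`. -/
noncomputable def lieAlgebraMap (f : G →* G') : GroupLieAlgebra I G →L[𝕜] GroupLieAlgebra J G' :=
  mfderiv I J f 1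

/-- An isomorphism of Lie groups, given as a group isomorphism which is `C^n` in both directions,
as a diffeomorphism. -/
def toDiffeomorph {n : ℕ∞ω} (e : G ≃* G')
    (he : ContMDiff I J n e) (he_symm : ContMDiff J I n e.symm) : G ≃ₘ^n⟮I, J⟯ G' :=
  ⟨e.toEquiv, he, he_symm⟩

lemma mfderiv_mulInvariantVectorField [ContMDiffMul I 1 G] [ContMDiffMul J 1 G']
    {f : G →* G'} (hf : MDifferentiable I J f) (v : GroupLieAlgebra I G) (g : G) :
    mfderiv I J f g (mulInvariantVectorField v g) =
      mulInvariantVectorField (lieAlgebraMap I J f v) (f g) := by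
  have intertwine : f ∘ (g * ·) = (f g * ·) ∘ f := funext fun h ↦ map_mul f g h
  have left : mfderiv I J (f ∘ (g * ·)) 1 v = mfderiv I J f g (mulInvariantVectorField v g) :=
    mfderiv_comp_apply_of_eq 1 (hf g) mdifferentiableAt_mul_left (mul_one g) v
  have right : mfderiv I J ((f g * ·) ∘ f) 1 v =
      mulInvariantVectorField (lieAlgebraMap I J f v) (f g) :=
    mfderiv_comp_apply_of_eq 1 mdifferentiableAt_mul_left (hf 1) (map_one f) v
  rw [intertwine] at left
  exact left.symm.trans right

lemma mpullback_mulInvariantVectorField_lieAlgebraMap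
    [ContMDiffMul I 1 G] [ContMDiffMul J 1 G'] {f : G →* G'}
    (hf : ∀ g, (mfderiv I J f g).IsInvertible) (v : GroupLieAlgebra I G) :
    mpullback I J f (mulInvariantVectorField (lieAlgebraMap I J f v)) =
      mulInvariantVectorField v := by
  have hf_diff : MDifferentiable I J f := fun g ↦ mdifferentiableAt_of_isInvertible_mfderiv (hf g)
  ext g
  rw [mpullback_apply, (hf g).inverse_apply_eq, mfderiv_mulInvariantVectorField hf_diff]

lemma contMDiffMul_one_of_minSmoothness [ContMDiffMul I (minSmoothness 𝕜 3) G] :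
    ContMDiffMul I 1 G :=
  ContMDiffMul.of_le (n := minSmoothness 𝕜 3) (le_trans (by norm_num) le_minSmoothness)

variable [LieGroup I (minSmoothness 𝕜 3) G] [LieGroup J (minSmoothness 𝕜 3) G'] {n : ℕ∞ω}

lemma lieAlgebraMap_lie [CompleteSpace E] (hn : minSmoothness 𝕜 2 ≤ n) {f : G →* G'}
    (hf : ContMDiff I J n f) (hf_inv : ∀ g, (mfderiv I J f g).IsInvertible)
    (v w : GroupLieAlgebra I G) :
    lieAlgebraMap I J f ⁅v, w⁆ = ⁅lieAlgebraMap I J f v, lieAlgebraMap I J f w⁆ := by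
  have : ContMDiffMul I 1 G := contMDiffMul_one_of_minSmoothness
  have : ContMDiffMul J 1 G' := contMDiffMul_one_of_minSmoothness
  have bracket_pullback := mpullback_mlieBracket (x₀ := (1 : G))
    (mdifferentiableAt_mulInvariantVectorField (lieAlgebraMap I J f v))
    (mdifferentiableAt_mulInvariantVectorField (lieAlgebraMap I J f w)) hf.contMDiffAt hn
  rw [mpullback_mulInvariantVectorField_lieAlgebraMap hf_inv,
    mpullback_mulInvariantVectorField_lieAlgebraMap hf_inv, mpullback_apply,
    (hf_inv 1).inverse_apply_eq, map_one] at bracket_pullback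
  exact bracket_pullback.symm

/-- The isomorphism of Lie algebras induced by an isomorphism of Lie groups, given by its
differential at the identity. -/
noncomputable def lieAlgebraEquiv [CompleteSpace E] [CompleteSpace E']
    (hn : minSmoothness 𝕜 2 ≤ n) (e : G ≃* G')
    (he : ContMDiff I J n e) (he_symm : ContMDiff J I n e.symm) :
    GroupLieAlgebra I G ≃ₗ⁅𝕜⁆ GroupLieAlgebra J G' :=
  have hn_ne_zero : n ≠ 0 := (two_pos.trans_le (le_minSmoothness.trans hn)).ne'
  let differentialAt := (toDiffeomorph e he he_symm).mfderivToContinuousLinearEquiv hn_ne_zero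
  { (differentialAt 1).toLinearEquiv with
    map_lie' := lieAlgebraMap_lie hn (f := (e : G →* G')) he
      (fun g ↦ ⟨differentialAt g, rfl⟩) _ _ }

lemma lieAlgebraEquiv_apply [CompleteSpace E] [CompleteSpace E']
    (hn : minSmoothness 𝕜 2 ≤ n) (e : G ≃* G')
    (he : ContMDiff I J n e) (he_symm : ContMDiff J I n e.symm) (v : GroupLieAlgebra I G) :
    lieAlgebraEquiv hn e he he_symm v = lieAlgebraMap I J (e : G →* G') v :=
  rfl

end LieAlgebraMap

section KillingMetric

variable {E : Type*} [NormedAddCommGroup E] [NormedSpace ℝ E]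
  {E' : Type*} [NormedAddCommGroup E'] [NormedSpace ℝ E']
  {H : Type*} [TopologicalSpace H] {I : ModelWithCorners ℝ E H}
  {H' : Type*} [TopologicalSpace H'] {J : ModelWithCorners ℝ E' H'}
  {G : Type*} [TopologicalSpace G] [ChartedSpace H G] [Group G]
  {G' : Type*} [TopologicalSpace G'] [ChartedSpace H' G'] [Group G']

lemma toLieAlgebra_mulInvariantVectorField [ContMDiffMul I 1 G] (v : GroupLieAlgebra I G) (g : G) :
    toLieAlgebra I g (mulInvariantVectorField v g) = v := by
  have chain_rule : mfderiv I I ((g⁻¹ * ·) ∘ (g * ·)) 1 v =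
      toLieAlgebra I g (mulInvariantVectorField v g) :=
    mfderiv_comp_apply_of_eq 1 mdifferentiableAt_mul_left mdifferentiableAt_mul_left (mul_one g) v
  have cancel : ((g⁻¹ * ·) ∘ (g * ·) : G → G) = id := funext (inv_mul_cancel_left g)
  rw [cancel, mfderiv_id] at chain_rule
  exact chain_rule.symm

lemma mulInvariantVectorField_toLieAlgebra [ContMDiffMul I 1 G] (g : G) (v : TangentSpace I g) :
    mulInvariantVectorField (toLieAlgebra I g v) g = v := by
  have chain_rule : mfderiv I I ((g * ·) ∘ (g⁻¹ * ·)) g v =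
      mulInvariantVectorField (toLieAlgebra I g v) g :=
    mfderiv_comp_apply_of_eq g mdifferentiableAt_mul_left mdifferentiableAt_mul_left
      (inv_mul_cancel g) v
  have cancel : ((g * ·) ∘ (g⁻¹ * ·) : G → G) = id := funext (mul_inv_cancel_left g)
  rw [cancel, mfderiv_id] at chain_rule
  exact chain_rule.symm

lemma toLieAlgebra_mfderiv [ContMDiffMul I 1 G] [ContMDiffMul J 1 G']
    {f : G →* G'} (hf : MDifferentiable I J f) (g : G) (v : TangentSpace I g) :
    toLieAlgebra J (f g) (mfderiv I J f g v) = lieAlgebraMap I J f (toLieAlgebra I g v) := by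
  rw [← toLieAlgebra_mulInvariantVectorField (lieAlgebraMap I J f (toLieAlgebra I g v)) (f g),
    ← mfderiv_mulInvariantVectorField hf, mulInvariantVectorField_toLieAlgebra]

variable [CompleteSpace E] [CompleteSpace E'] [LieGroup I ∞ G] [LieGroup J ∞ G'] {n : ℕ∞ω}

lemma killingMetric_mfderiv (hn : 2 ≤ n) (e : G ≃* G')
    (he : ContMDiff I J n e) (he_symm : ContMDiff J I n e.symm) (g : G)
    (v w : TangentSpace I g) :
    killingMetric J (e g) (mfderiv I J e g v) (mfderiv I J e g w) = killingMetric I g v w := by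
  have hn' : minSmoothness ℝ 2 ≤ n := by rwa [minSmoothness_of_isRCLikeNormedField]
  have left_trivialization (u : TangentSpace I g) :
      toLieAlgebra J (e g) (mfderiv I J e g u) =
        lieAlgebraEquiv hn' e he he_symm (toLieAlgebra I g u) := by
    rw [lieAlgebraEquiv_apply]
    exact toLieAlgebra_mfderiv (f := (e : G →* G'))
      (he.mdifferentiable (two_pos.trans_le hn).ne') g u
  simp only [killingMetric, left_trivialization, LieAlgebra.killingForm_of_equiv_apply]

lemma killingEDist_map (hn : 2 ≤ n) (e : G ≃* G')
    (he : ContMDiff I J n e) (he_symm : ContMDiff J I n e.symm) (x y : G) :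
    killingEDist J (e x) (e y) = killingEDist I x y := by
  let := killingENorm I (G := G)
  let := killingENorm J (G := G')
  have preserves_enorm (g : G) (v : TangentSpace I g) : ‖mfderiv I J e g v‖ₑ = ‖v‖ₑ :=
    congrArg (fun r ↦ ENNReal.ofReal √r) (killingMetric_mfderiv hn e he he_symm g v v)
  exact riemannianEDist_diffeomorph (two_pos.trans_le hn).ne' (toDiffeomorph e he he_symm)
    preserves_enorm x y

end KillingMetric

section LinearVectorField

variable {E : Type*} [NormedAddCommGroup E] [NormedSpace ℝ E]
  {H : Type*} [TopologicalSpace H] {I : ModelWithCorners ℝ E H}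
  {G : Type*} [TopologicalSpace G] [ChartedSpace H G] [Group G]

lemma IsLieGroupAutomorphism.bijective {f : G → G} (hf : IsLieGroupAutomorphism I f) :
    Function.Bijective f := by
  obtain ⟨e, rfl, -, -⟩ := hf
  exact e.bijective

variable [LieGroup I ∞ G]

lemma IsLieGroupAutomorphism.killingEDist_eq [CompleteSpace E] {f : G → G}
    (hf : IsLieGroupAutomorphism I f) (x y : G) :
    killingEDist I (f x) (f y) = killingEDist I x y := by
  obtain ⟨e, rfl, he, he_symm⟩ := hf
  exact killingEDist_map ENat.LEInfty.out e he he_symm x y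

lemma IsLinearVectorField.isLieGroupAutomorphism [BoundarylessManifold I G] [T2Space G]
    {X : (g : G) → TangentSpace I g} (hX : IsLinearVectorField I X) {φ : ℝ → G → G}
    (hφ : IsFlowOf I X φ) (t : ℝ) : IsLieGroupAutomorphism I (φ t) := by
  have : IsManifold I 1 G := IsManifold.of_le (n := ∞) ENat.LEInfty.out
  obtain ⟨ψ, hψ, hψ_aut⟩ := hX.exists_flow
  rw [hφ.unique (hX.contMDiff.of_le ENat.LEInfty.out) hψ]
  exact hψ_aut t

end LinearVectorField

end KillingIsometry

theorem mainTheorem9_general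
    {E : Type*} [NormedAddCommGroup E] [NormedSpace ℝ E] [FiniteDimensional ℝ E] [CompleteSpace E]
    {H : Type*} [TopologicalSpace H] (I : ModelWithCorners ℝ E H)
    {G : Type*} [TopologicalSpace G] [ChartedSpace H G] [Group G] [LieGroup I ∞ G]
    [BoundarylessManifold I G] [T2Space G] [CompactSpace G]
    (X : (g : G) → TangentSpace I g) (hX : KillingIsometry.IsLinearVectorField I X)
    (φ : ℝ → G → G) (hφ : KillingIsometry.IsFlowOf I X φ) (t : ℝ) :
    Function.Bijective (φ t) ∧
      ∀ g h : G, KillingIsometry.killingEDist I (φ t g) (φ t h) =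
        KillingIsometry.killingEDist I g h :=
  have automorphism := hX.isLieGroupAutomorphism hφ t
  ⟨automorphism.bijective, automorphism.killingEDist_eq⟩

theorem mainTheorem9
    {E : Type*} [NormedAddCommGroup E] [NormedSpace ℝ E] [FiniteDimensional ℝ E] [CompleteSpace E]
    {H : Type*} [TopologicalSpace H] (I : ModelWithCorners ℝ E H)
    {G : Type*} [TopologicalSpace G] [ChartedSpace H G] [Group G] [LieGroup I ∞ G]
    [BoundarylessManifold I G] [T2Space G] [ConnectedSpace G] [CompactSpace G]
    [LieAlgebra.IsSemisimple ℝ (GroupLieAlgebra I G)]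
    (X : (g : G) → TangentSpace I g) (hX : KillingIsometry.IsLinearVectorField I X)
    (φ : ℝ → G → G) (hφ : KillingIsometry.IsFlowOf I X φ) (t : ℝ) :
    Function.Bijective (φ t) ∧
      ∀ g h : G, KillingIsometry.killingEDist I (φ t g) (φ t h) =
        KillingIsometry.killingEDist I g h :=
  mainTheorem9_general I X hX φ hφ t
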